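/- Let $\alpha<\frac12$, $\alpha\neq 0$, and $1\le p\le\infty$. For every $f\in L^p(0,1)$ there is a unique function $u_D\in W^{2,p}_{loc}((0,1])$ (identified with its continuous representative on $(0,1]$) such that $$-(x^{2\alpha}u_D'(x))'+u_D(x)=f(x)\ \text{ for a.e. } x\in(0,1),\qquad u_D(1)=0,\qquad \lim_{x\to0^+}u_D(x)=0.$$ Here $u\in W^{2,p}_{loc}((0,1])$ means $u\in W^{2,p}(\varepsilon,1)$ for every $\varepsilon\in(0,1)$. For $x\in(0,1]$ define $$K_D(x)=\sup_{\|f\|_{L^p(0,1)}\le 1}\left|x^{2\alpha-1}u_D(x)\right|,$$ where $u_D$ is the solution with datum $f$. Then there exist constants $\varepsilon_0\in(0,1)$ and $0<C_1<C_2$, depending only on $\alpha$ and $p$, such that $$C_1\le K_D(x)\le C_2\qquad\text{for all } 0<x\le\varepsilon_0.$$ -/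

import Mathlib

open MeasureTheory Set Filter Topology
open scoped ENNReal

/-- `v` is the weak (distributional) derivative of `u` on the open interval `(a, b)`: both are
locally integrable there, and `∫ u φ' = -∫ v φ` for every test function `φ ∈ C_c^∞(a, b)`. -/
def HasWeakDerivOn (u v : ℝ → ℝ) (a b : ℝ) : Prop :=
  LocallyIntegrableOn u (Ioo a b) volume ∧
  LocallyIntegrableOn v (Ioo a b) volume ∧
  ∀ φ : ℝ → ℝ, ContDiff ℝ (⊤ : ℕ∞) φ → HasCompactSupport φ → tsupport φ ⊆ Ioo a b →
    ∫ x in Ioo a b, u x * deriv φ x = -∫ x in Ioo a b, v x * φ x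

/-- `g ∈ L^p_loc((0, 1])`: `g ∈ L^p(ε, 1)` for every `0 < ε < 1`. -/
def MemLpLocZeroOne (g : ℝ → ℝ) (p : ℝ≥0∞) : Prop :=
  ∀ ε ∈ Ioo (0 : ℝ) 1, MemLp g p (volume.restrict (Ioo ε 1))

/-- `u` is a strong solution of the Dirichlet problem
`-(x^{2α} u')' + u = f` a.e. on `(0, 1)`, `u(1) = 0`, `lim_{x → 0⁺} u(x) = 0`,
in the class `W^{2,p}_loc((0, 1])`. Elements of that class are identified with their
continuous representatives on `(0, 1]`; values of `u` outside `(0, 1]` play no role. -/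
structure IsDirichletSolution (α : ℝ) (p : ℝ≥0∞) (f u : ℝ → ℝ) : Prop where
  continuousOn : ContinuousOn u (Ioc 0 1)
  /-- `u ∈ W^{2,p}_loc((0, 1])` with first and second weak derivatives `u₁`, `u₂`, and the weak
  derivative `w` of `x^{2α} u₁` satisfies the equation almost everywhere. -/
  equation : ∃ u₁ u₂ w : ℝ → ℝ,
    HasWeakDerivOn u u₁ 0 1 ∧ HasWeakDerivOn u₁ u₂ 0 1 ∧
    MemLpLocZeroOne u p ∧ MemLpLocZeroOne u₁ p ∧ MemLpLocZeroOne u₂ p ∧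
    HasWeakDerivOn (fun x => x ^ (2 * α) * u₁ x) w 0 1 ∧
    ∀ᵐ x ∂(volume.restrict (Ioo (0 : ℝ) 1)), -w x + u x = f x
  boundary_one : u 1 = 0
  boundary_zero : Tendsto u (𝓝[>] 0) (𝓝 0)

/-- `K_D(x) = sup { |x^{2α-1} u_D(x)| : ‖f‖_{L^p(0,1)} ≤ 1 }`, with `u_D` the solution of the
Dirichlet problem with datum `f`, as a supremum in `[0, ∞]`. -/
noncomputable def dirichletK (α : ℝ) (p : ℝ≥0∞) (x : ℝ) : ℝ≥0∞ :=
  ⨆ (f : ℝ → ℝ) (u : ℝ → ℝ)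
    (_ : MemLp f p (volume.restrict (Ioo (0 : ℝ) 1)) ∧
      eLpNorm f p (volume.restrict (Ioo (0 : ℝ) 1)) ≤ 1 ∧
      IsDirichletSolution α p f u),
    ENNReal.ofReal |x ^ (2 * α - 1) * u x|

theorem IsCompact.exists_subset_Ioo {k : Set ℝ} {a b : ℝ} (hk : IsCompact k) (hab : a < b)
    (hkab : k ⊆ Ioo a b) : ∃ c d, a < c ∧ c < d ∧ d < b ∧ k ⊆ Ioo c d := by
  rcases k.eq_empty_or_nonempty with rfl | hne
  · exact ⟨(2 * a + b) / 3, (a + 2 * b) / 3, by linarith, by linarith, by linarith, by simp⟩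
  · obtain ⟨m, hm, hm'⟩ := hk.exists_isLeast hne
    obtain ⟨M, hM, hM'⟩ := hk.exists_isGreatest hne
    have h1 := hkab hm
    have h2 := hkab hM
    have h3 := hm' hM
    exact ⟨(a + m) / 2, (M + b) / 2, by linarith [h1.1], by linarith [h1.1, h2.2],
      by linarith [h2.2], fun x hx => ⟨by linarith [h1.1, hm' hx], by linarith [h2.2, hM' hx]⟩⟩

theorem locallyIntegrableOn_Ioo_of_intervalIntegrable {f : ℝ → ℝ} {a b : ℝ} (hab : a < b)
    (h : ∀ c d, a < c → c < d → d < b → IntervalIntegrable f volume c d) :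
    LocallyIntegrableOn f (Ioo a b) volume := by
  rw [locallyIntegrableOn_iff isOpen_Ioo.isLocallyClosed]
  intro k hk hkc
  obtain ⟨c, d, hc, hcd, hd, hs⟩ := hkc.exists_subset_Ioo hab hk
  have := (intervalIntegrable_iff_integrableOn_Ioo_of_le hcd.le).1 (h c d hc hcd hd)
  exact this.mono_set hs

theorem MeasureTheory.LocallyIntegrableOn.intervalIntegrable_of_Ioo {f : ℝ → ℝ} {a b c d : ℝ}
    (hf : LocallyIntegrableOn f (Ioo a b) volume) (hc : c ∈ Ioo a b) (hd : d ∈ Ioo a b) :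
    IntervalIntegrable f volume c d := by
  have := hf.integrableOn_compact_subset (ordConnected_Ioo.uIcc_subset hc hd) isCompact_uIcc
  exact this.intervalIntegrable

theorem MeasureTheory.LocallyIntegrableOn.integrableOn_mul_test {u φ : ℝ → ℝ} {a b : ℝ}
    (hu : LocallyIntegrableOn u (Ioo a b) volume) (hφ : Continuous φ)
    (hc : HasCompactSupport φ) (hs : tsupport φ ⊆ Ioo a b) :
    IntegrableOn (fun x => u x * φ x) (Ioo a b) := by
  have h1 : IntegrableOn u (tsupport φ) := hu.integrableOn_compact_subset hs hc
  have h2 : IntegrableOn (fun x => u x * φ x) (tsupport φ) :=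
    h1.mul_continuousOn hφ.continuousOn hc
  have h3 : Integrable (fun x => u x * φ x) := by
    refine (integrableOn_iff_integrable_of_support_subset ?_).1 h2
    intro x hx
    apply subset_tsupport
    simp only [Function.mem_support] at hx ⊢
    exact right_ne_zero_of_mul hx
  exact h3.integrableOn

theorem HasWeakDerivOn.sub {u v u' v' : ℝ → ℝ} {a b : ℝ} (hu : HasWeakDerivOn u u' a b)
    (hv : HasWeakDerivOn v v' a b) :
    HasWeakDerivOn (fun x => u x - v x) (fun x => u' x - v' x) a b := by
  refine ⟨hu.1.sub hv.1, hu.2.1.sub hv.2.1, fun φ h1 h2 h3 => ?_⟩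
  have hd : Continuous (deriv φ) := h1.continuous_deriv (by simp)
  have hs : tsupport (deriv φ) ⊆ Ioo a b := (tsupport_deriv_subset).trans h3
  simp only [sub_mul]
  rw [integral_sub (hu.1.integrableOn_mul_test hd h2.deriv hs)
      (hv.1.integrableOn_mul_test hd h2.deriv hs),
    integral_sub (hu.2.1.integrableOn_mul_test h1.continuous h2 h3)
      (hv.2.1.integrableOn_mul_test h1.continuous h2 h3), hu.2.2 φ h1 h2 h3, hv.2.2 φ h1 h2 h3]
  ring

theorem exists_test_function_integral_eq_one {a b : ℝ} (hab : a < b) :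
    ∃ ρ : ℝ → ℝ, ContDiff ℝ (⊤ : ℕ∞) ρ ∧ HasCompactSupport ρ ∧ tsupport ρ ⊆ Ioo a b ∧
      ∫ x, ρ x = 1 := by
  let B : ContDiffBump ((a + b) / 2) := ⟨(b - a) / 8, (b - a) / 4, by linarith, by linarith⟩
  refine ⟨B.normed volume, B.contDiff_normed, B.hasCompactSupport_normed, ?_, B.integral_normed⟩
  rw [B.tsupport_normed_eq, Real.closedBall_eq_Icc]
  intro x hx
  have h1 : (a + b) / 2 - (b - a) / 4 ≤ x := hx.1
  have h2 : x ≤ (a + b) / 2 + (b - a) / 4 := hx.2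
  constructor <;> linarith

/-- A test function with vanishing integral is the derivative of a test function. -/
theorem exists_test_function_deriv_eq {η : ℝ → ℝ} {a b : ℝ} (hab : a < b)
    (h1 : ContDiff ℝ (⊤ : ℕ∞) η) (h2 : HasCompactSupport η) (h3 : tsupport η ⊆ Ioo a b)
    (h0 : ∫ x, η x = 0) :
    ∃ φ : ℝ → ℝ, ContDiff ℝ (⊤ : ℕ∞) φ ∧ HasCompactSupport φ ∧ tsupport φ ⊆ Ioo a b ∧
      deriv φ = η := by
  obtain ⟨c, d, hc, hcd, hd, hs⟩ := IsCompact.exists_subset_Ioo h2 hab h3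
  have hz : ∀ x, x ∉ Ioo c d → η x = 0 := fun x hx =>
    image_eq_zero_of_notMem_tsupport fun h => hx (hs h)
  have hder : ∀ x, HasDerivAt (fun x => ∫ t in c..x, η t) (η x) x := fun x =>
    intervalIntegral.integral_hasDerivAt_right (h1.continuous.intervalIntegrable _ _)
      (h1.continuous.stronglyMeasurableAtFilter _ _) h1.continuous.continuousAt
  have hdd : deriv (fun x => ∫ t in c..x, η t) = η := funext fun x => (hder x).deriv
  have hleft : ∀ x ≤ c, ∫ t in c..x, η t = 0 := fun x hx => by
    rw [intervalIntegral.integral_congr (g := fun _ => 0)]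
    · simp
    · intro t ht
      rw [uIcc_of_ge hx] at ht
      exact hz t fun h => absurd h.1 (not_lt.2 ht.2)
  have hright : ∀ x, d ≤ x → ∫ t in c..x, η t = 0 := fun x hx => by
    rw [intervalIntegral.integral_eq_integral_of_support_subset, h0]
    intro t ht
    have : t ∈ Ioo c d := by
      by_contra h
      exact ht (hz t h)
    exact ⟨this.1, this.2.le.trans hx⟩
  have hts : tsupport (fun x => ∫ t in c..x, η t) ⊆ Icc c d := by
    refine closure_minimal ?_ isClosed_Icc
    intro x hx
    by_contra h
    rw [mem_Icc, not_and_or, not_le, not_le] at h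
    rcases h with h | h
    · exact hx (hleft x h.le)
    · exact hx (hright x h.le)
  refine ⟨_, ?_, ?_, hts.trans (Icc_subset_Ioo hc hd), hdd⟩
  · rw [show ((⊤ : ℕ∞) : WithTop ℕ∞) = (⊤ : ℕ∞) + 1 by rfl, contDiff_succ_iff_deriv]
    exact ⟨fun x => (hder x).differentiableAt, by simp, by rw [hdd]; exact h1⟩
  · exact isCompact_Icc.of_isClosed_subset (isClosed_tsupport _) hts

theorem HasWeakDerivOn.exists_ae_eq_const {u v : ℝ → ℝ} {a b : ℝ} (hab : a < b)
    (hu : HasWeakDerivOn u v a b) (hv : ∀ᵐ x, x ∈ Ioo a b → v x = 0) :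
    ∃ C : ℝ, ∀ᵐ x, x ∈ Ioo a b → u x = C := by
  obtain ⟨ρ, r1, r2, r3, r4⟩ := exists_test_function_integral_eq_one hab
  refine ⟨∫ x in Ioo a b, u x * ρ x, ?_⟩
  set C := ∫ x in Ioo a b, u x * ρ x with hC
  have hl : LocallyIntegrableOn (fun x => u x - C) (Ioo a b) volume :=
    hu.1.sub ((locallyIntegrable_const C).locallyIntegrableOn _)
  have key := isOpen_Ioo.ae_eq_zero_of_integral_contDiff_smul_eq_zero (f := fun x => u x - C) hl ?_
  · filter_upwards [key] with x hx hxm using sub_eq_zero.1 (hx hxm)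
  intro g g1 g2 g3
  have hgi : Integrable g := g1.continuous.integrable_of_hasCompactSupport g2
  have hρi : Integrable ρ := r1.continuous.integrable_of_hasCompactSupport r2
  have hsupp : ∀ h : ℝ → ℝ, tsupport h ⊆ Ioo a b → ∀ k : ℝ → ℝ,
      ∫ x, k x * h x = ∫ x in Ioo a b, k x * h x := fun h hh k => by
    symm
    apply setIntegral_eq_integral_of_forall_compl_eq_zero
    intro x hx
    rw [image_eq_zero_of_notMem_tsupport fun h => hx (hh h), mul_zero]
  have e1 : ContDiff ℝ (⊤ : ℕ∞) (fun x => g x - (∫ y, g y) * ρ x) := g1.sub (contDiff_const.mul r1)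
  have e2 : HasCompactSupport (fun x => g x - (∫ y, g y) * ρ x) :=
    g2.sub (r2.mul_left (f := fun _ => ∫ y, g y))
  have e3 : tsupport (fun x => g x - (∫ y, g y) * ρ x) ⊆ Ioo a b := by
    refine (tsupport_sub g (fun x => (∫ y, g y) * ρ x)).trans (union_subset g3 ?_)
    exact (tsupport_mul_subset_right (f := fun _ => ∫ y, g y)).trans r3
  have e4 : ∫ x, (g x - (∫ y, g y) * ρ x) = 0 := by
    rw [integral_sub hgi (hρi.const_mul _), integral_const_mul, r4]
    ring
  obtain ⟨φ, f1, f2, f3, f4⟩ := exists_test_function_deriv_eq hab e1 e2 e3 e4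
  have h := hu.2.2 φ f1 f2 f3
  have h0 : ∫ x in Ioo a b, v x * φ x = 0 := by
    apply integral_eq_zero_of_ae
    rw [EventuallyEq, ae_restrict_iff' measurableSet_Ioo]
    filter_upwards [hv] with x hx hxm
    simp [hx hxm]
  have hug := hu.1.integrableOn_mul_test g1.continuous g2 g3
  have huρ := hu.1.integrableOn_mul_test r1.continuous r2 r3
  rw [h0, f4] at h
  have h5 : ∫ x in Ioo a b, u x * (g x - (∫ y, g y) * ρ x)
      = (∫ x in Ioo a b, u x * g x) - (∫ y, g y) * C := by
    rw [hC, ← integral_const_mul, ← integral_sub hug (huρ.const_mul _)]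
    congr 1
    ext x
    ring
  have h6 : ∫ x, g x • (u x - C) = ∫ x in Ioo a b, (u x * g x - C * g x) := by
    rw [← setIntegral_eq_integral_of_forall_compl_eq_zero (s := Ioo a b)]
    · congr 1
      ext x
      simp only [smul_eq_mul]
      ring
    · intro x hx
      rw [image_eq_zero_of_notMem_tsupport fun h => hx (g3 h), zero_smul]
  have h7 := hsupp g g3 (fun _ => C)
  rw [h6, integral_sub hug (hgi.const_mul C).integrableOn, ← h7, integral_const_mul]
  linarith

/-- `U` is locally absolutely continuous on `(a, b)` with almost everywhere derivative `v`. -/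
def HasACDerivOn (U v : ℝ → ℝ) (a b : ℝ) : Prop :=
  (∀ c d, a < c → c < d → d < b → AbsolutelyContinuousOnInterval U c d) ∧
  ∀ᵐ x, x ∈ Ioo a b → HasDerivAt U (v x) x

namespace HasACDerivOn

variable {U V u v : ℝ → ℝ} {a b : ℝ}

theorem add (hU : HasACDerivOn U u a b) (hV : HasACDerivOn V v a b) :
    HasACDerivOn (fun x => U x + V x) (fun x => u x + v x) a b := by
  refine ⟨fun c d h1 h2 h3 => (hU.1 c d h1 h2 h3).add (hV.1 c d h1 h2 h3), ?_⟩
  filter_upwards [hU.2, hV.2] with x h1 h2 hx using (h1 hx).add (h2 hx)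

theorem mul (hU : HasACDerivOn U u a b) (hV : HasACDerivOn V v a b) :
    HasACDerivOn (fun x => U x * V x) (fun x => u x * V x + U x * v x) a b := by
  refine ⟨fun c d h1 h2 h3 => (hU.1 c d h1 h2 h3).mul (hV.1 c d h1 h2 h3), ?_⟩
  filter_upwards [hU.2, hV.2] with x h1 h2 hx using (h1 hx).mul (h2 hx)

theorem congr (hU : HasACDerivOn U u a b) (h : ∀ᵐ x, x ∈ Ioo a b → u x = v x) :
    HasACDerivOn U v a b := by
  refine ⟨hU.1, ?_⟩
  filter_upwards [hU.2, h] with x h1 h2 hx using h2 hx ▸ h1 hx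

theorem of_hasDerivAt (h : ∀ x ∈ Ioo a b, HasDerivAt U (u x) x) (hu : ContinuousOn u (Ioo a b)) :
    HasACDerivOn U u a b := by
  refine ⟨fun c d h1 h2 h3 => ?_, Eventually.of_forall h⟩
  have hs : uIcc c d ⊆ Ioo a b := by
    rw [uIcc_of_le h2.le]
    exact Icc_subset_Ioo h1 h3
  obtain ⟨C, hC⟩ := isCompact_uIcc.exists_bound_of_continuousOn (hu.mono hs)
  refine (Convex.lipschitzOnWith_of_nnnorm_hasDerivWithin_le (C := C.toNNReal) (convex_uIcc c d)
    (fun x hx => (h x (hs hx)).hasDerivWithinAt) fun x hx => ?_).absolutelyContinuousOnInterval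
  rw [← NNReal.coe_le_coe, coe_nnnorm]
  exact (hC x hx).trans (Real.le_coe_toNNReal C)

theorem continuousOn (hU : HasACDerivOn U u a b) : ContinuousOn U (Ioo a b) := by
  intro x hx
  have h1 : a < (a + x) / 2 := by linarith [hx.1]
  have h2 : (a + x) / 2 < (x + b) / 2 := by linarith [hx.1, hx.2]
  have := (hU.1 _ _ h1 h2 (by linarith [hx.2])).continuousOn
  rw [uIcc_of_le h2.le] at this
  exact (this.continuousAt (Icc_mem_nhds (by linarith [hx.1]) (by linarith [hx.2]))).continuousWithinAt

theorem ae_deriv_eq (hU : HasACDerivOn U u a b) : ∀ᵐ x, x ∈ Ioo a b → deriv U x = u x := by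
  filter_upwards [hU.2] with x h hx using (h hx).deriv

theorem locallyIntegrableOn (hab : a < b) (hU : HasACDerivOn U u a b) :
    LocallyIntegrableOn u (Ioo a b) volume := by
  refine locallyIntegrableOn_Ioo_of_intervalIntegrable hab fun c d h1 h2 h3 => ?_
  refine (hU.1 c d h1 h2 h3).intervalIntegrable_deriv.congr_ae ?_
  rw [EventuallyEq, ae_restrict_iff' measurableSet_uIoc]
  filter_upwards [hU.ae_deriv_eq] with x hx hxm
  rw [uIoc_of_le h2.le] at hxm
  exact hx ⟨h1.trans hxm.1, hxm.2.trans_lt h3⟩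

theorem hasWeakDerivOn (hab : a < b) (hU : HasACDerivOn U u a b) : HasWeakDerivOn U u a b := by
  refine ⟨hU.continuousOn.locallyIntegrableOn measurableSet_Ioo, hU.locallyIntegrableOn hab,
    fun φ h1 h2 h3 => ?_⟩
  obtain ⟨c, d, hc, hcd, hd, hs⟩ := IsCompact.exists_subset_Ioo h2 hab h3
  have hφ : AbsolutelyContinuousOnInterval φ c d :=
    (h1.contDiffOn.of_le (by simp)).absolutelyContinuousOnInterval
  have key := (hU.1 c d hc hcd hd).integral_mul_deriv_eq_deriv_mul hφ
  have hz : ∀ x, x ∉ Ioo c d → φ x = 0 := fun x hx =>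
    image_eq_zero_of_notMem_tsupport fun h => hx (hs h)
  have hz' : ∀ x, x ∉ Ioo c d → deriv φ x = 0 := fun x hx =>
    image_eq_zero_of_notMem_tsupport fun h => hx (hs (tsupport_deriv_subset h))
  have hr : ∀ f g : ℝ → ℝ, (∀ x, x ∉ Ioo c d → g x = 0) →
      ∫ x in c..d, f x * g x = ∫ x in Ioo a b, f x * g x := fun f g hg => by
    rw [intervalIntegral.integral_of_le hcd.le, integral_Ioc_eq_integral_Ioo]
    symm
    apply setIntegral_eq_of_subset_of_forall_sdiff_eq_zero measurableSet_Ioo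
      (Ioo_subset_Ioo hc.le hd.le)
    intro x hx
    rw [hg x hx.2, mul_zero]
  rw [hr U _ hz', hr _ _ hz, hz c (by simp), hz d (by simp)] at key
  rw [key, mul_zero, mul_zero, sub_zero, zero_sub, neg_inj]
  apply integral_congr_ae
  rw [EventuallyEq, ae_restrict_iff' measurableSet_Ioo]
  filter_upwards [hU.ae_deriv_eq] with x hx hxm
  rw [hx hxm]

end HasACDerivOn

/-- A function whose weak derivative is continuous is almost everywhere equal to a `C¹` function. -/
theorem HasWeakDerivOn.exists_hasDerivAt {u v g : ℝ → ℝ} {a b : ℝ} (hab : a < b)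
    (hu : HasWeakDerivOn u v a b) (hg : ContinuousOn g (Ioo a b))
    (hv : ∀ᵐ x, x ∈ Ioo a b → v x = g x) :
    ∃ U : ℝ → ℝ, (∀ x ∈ Ioo a b, HasDerivAt U (g x) x) ∧ ∀ᵐ x, x ∈ Ioo a b → u x = U x := by
  have hm : (a + b) / 2 ∈ Ioo a b := ⟨by linarith, by linarith⟩
  have hli := hg.locallyIntegrableOn (μ := volume) measurableSet_Ioo
  have hder : ∀ x ∈ Ioo a b, HasDerivAt (fun x => ∫ t in (a + b) / 2..x, g t) (g x) x :=
    fun x hx => intervalIntegral.integral_hasDerivAt_right (hli.intervalIntegrable_of_Ioo hm hx)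
      (hg.stronglyMeasurableAtFilter isOpen_Ioo x hx) (hg.continuousAt (isOpen_Ioo.mem_nhds hx))
  have hw := (HasACDerivOn.of_hasDerivAt hder hg).hasWeakDerivOn hab
  obtain ⟨C, hC⟩ := (hu.sub hw).exists_ae_eq_const hab (by
    filter_upwards [hv] with x hx hxm
    rw [hx hxm, sub_self])
  refine ⟨fun x => C + ∫ t in (a + b) / 2..x, g t, fun x hx => (hder x hx).const_add C, ?_⟩
  filter_upwards [hC] with x hx hxm
  linarith [hx hxm]

theorem norm_mul_natCast_mul_pow_pred_le {c z M : ℝ} (hM : 1 ≤ M) (hz : |z| ≤ M) (k : ℕ) :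
    ‖c * (k * z ^ (k - 1))‖ ≤ |c| * (2 * M) ^ k := by
  rw [norm_mul, norm_mul, norm_pow, mul_pow]
  simp only [Real.norm_eq_abs, Nat.abs_cast]
  have h1 : (k : ℝ) ≤ 2 ^ k := by exact_mod_cast k.lt_two_pow_self.le
  have h2 : |z| ^ (k - 1) ≤ M ^ k :=
    (pow_le_pow_left₀ (abs_nonneg z) hz _).trans (pow_le_pow_right₀ hM (Nat.sub_le k 1))
  gcongr

theorem summable_mul_natCast_mul_pow_pred {c : ℕ → ℝ} (hc : ∀ r : ℝ, Summable fun k => |c k| * r ^ k)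
    (z : ℝ) : Summable fun k => c k * (k * z ^ (k - 1)) :=
  (hc _).of_norm_bounded fun k =>
    norm_mul_natCast_mul_pow_pred_le (M := |z| + 1) (by linarith [abs_nonneg z]) (by linarith) k

theorem summable_mul_pow {c : ℕ → ℝ} (hc : ∀ r : ℝ, Summable fun k => |c k| * r ^ k)
    (z : ℝ) : Summable fun k => c k * z ^ k :=
  (hc |z|).of_norm_bounded fun k => by rw [norm_mul, norm_pow]; rfl

/-- Termwise differentiation of an entire power series. -/
theorem hasDerivAt_tsum_mul_pow {c : ℕ → ℝ} (hc : ∀ r : ℝ, Summable fun k => |c k| * r ^ k)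
    (z : ℝ) : HasDerivAt (fun z => ∑' k, c k * z ^ k) (∑' k, c k * (k * z ^ (k - 1))) z := by
  have hz : z ∈ Metric.ball (0 : ℝ) (|z| + 1) := by simp
  refine hasDerivAt_tsum_of_isPreconnected (t := Metric.ball 0 (|z| + 1))
    (u := fun k => |c k| * (2 * (|z| + 1)) ^ k) (hc _) Metric.isOpen_ball
    (convex_ball _ _).isPreconnected (fun k y _ => (hasDerivAt_pow k y).const_mul (c k))
    (fun k y hy => norm_mul_natCast_mul_pow_pred_le (by linarith [abs_nonneg z]) ?_ k)
    hz (summable_mul_pow hc z) hz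
  rw [mem_ball_zero_iff, Real.norm_eq_abs] at hy
  exact hy.le

/-- The increasing solution of `(x ^ (1 - γ) φ')' = φ`, as a system for `φ` and
`φ₁ = x ^ (1 - γ) φ'`. -/
theorem exists_homogeneous_solution {γ : ℝ} (hγ : 0 < γ) :
    ∃ (φ φ₁ : ℝ → ℝ) (A : ℝ), ∀ x ∈ Ioo (0 : ℝ) 2,
      HasDerivAt φ (x ^ (γ - 1) * φ₁ x) x ∧ HasDerivAt φ₁ (φ x) x ∧
      x ^ γ ≤ φ x ∧ φ x ≤ A * x ^ γ := by
  set β := γ + 1 with hβ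
  have hβ1 : 1 < β := by linarith
  let c : ℕ → ℝ := fun k => ∏ i ∈ Finset.range k, (((γ + (i + 1) * β) * ((i + 1) * β)))⁻¹
  have hpos : ∀ k, 0 < c k := fun k => Finset.prod_pos fun i _ => by positivity
  have hrec : ∀ k : ℕ, c (k + 1) * (γ + (k + 1) * β) * ((k + 1) * β) = c k := fun k => by
    rw [show c (k + 1) = c k * ((γ + (k + 1) * β) * ((k + 1) * β))⁻¹ from
      Finset.prod_range_succ _ _]
    generalize c k = C
    field_simp
  have hle : ∀ k : ℕ, c k ≤ 1 / (k.factorial : ℝ) := fun k => by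
    induction k with
    | zero => simp [c]
    | succ k ih =>
      rw [Nat.factorial_succ]
      push_cast
      have h1 : c (k + 1) * (k + 1) ≤ c k := by
        rw [← hrec k, mul_assoc]
        refine mul_le_mul_of_nonneg_left ?_ (hpos _).le
        have hk : (0 : ℝ) ≤ k := k.cast_nonneg
        have a1 : 1 ≤ γ + (k + 1) * β := by nlinarith
        have a2 : (k + 1 : ℝ) ≤ (k + 1) * β := by nlinarith
        nlinarith
      have hk : (0 : ℝ) < k + 1 := by positivity
      have hf : (0 : ℝ) < k.factorial := by exact_mod_cast k.factorial_pos
      rw [le_div_iff₀ (by positivity)]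
      rw [le_div_iff₀ hf] at ih
      nlinarith
  have hcs : ∀ r : ℝ, Summable fun k => |c k| * r ^ k := fun r => by
    refine (Real.summable_pow_div_factorial |r|).of_norm_bounded fun k => ?_
    rw [norm_mul, norm_pow, Real.norm_eq_abs, Real.norm_eq_abs, abs_abs, abs_of_pos (hpos k),
      div_eq_mul_one_div, mul_comm]
    exact mul_le_mul_of_nonneg_left (hle k) (by positivity)
  let d : ℕ → ℝ := fun k => c k * (γ + k * β)
  have hds : ∀ r : ℝ, Summable fun k => |d k| * r ^ k := fun r => by
    refine ((hcs (2 * |r|)).mul_left (γ + β)).of_norm_bounded fun k => ?_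
    have h2 : (k : ℝ) ≤ 2 ^ k := by exact_mod_cast k.lt_two_pow_self.le
    have h3 : (1 : ℝ) ≤ 2 ^ k := one_le_pow₀ (by norm_num)
    have h1 : γ + k * β ≤ (γ + β) * 2 ^ k := by nlinarith
    have hk : (0 : ℝ) ≤ γ + k * β := by positivity
    rw [norm_mul, norm_pow, Real.norm_eq_abs, Real.norm_eq_abs, abs_abs, abs_mul,
      abs_of_nonneg hk, mul_pow]
    calc |c k| * (γ + k * β) * |r| ^ k ≤ |c k| * ((γ + β) * 2 ^ k) * |r| ^ k := by gcongr
      _ = _ := by ring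
  let H : ℝ → ℝ := fun z => ∑' k, c k * z ^ k
  let K : ℝ → ℝ := fun z => ∑' k, d k * z ^ k
  let H' : ℝ → ℝ := fun z => ∑' k, c k * (k * z ^ (k - 1))
  have hH : ∀ z, HasDerivAt H (H' z) z := hasDerivAt_tsum_mul_pow hcs
  have hHK : ∀ z, γ * H z + β * z * H' z = K z := fun z => by
    simp only [H, H', K]
    rw [← tsum_mul_left, ← tsum_mul_left, ← Summable.tsum_add
      ((summable_mul_pow hcs z).mul_left _) ((summable_mul_natCast_mul_pow_pred hcs z).mul_left _)]
    congr 1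
    ext k
    rcases k with _ | k
    · simp [d]; ring
    · simp only [d, Nat.add_sub_cancel, pow_succ]; ring
  have hK : ∀ z, HasDerivAt K (H z / β) z := fun z => by
    convert! hasDerivAt_tsum_mul_pow hds z using 1
    rw [(summable_mul_natCast_mul_pow_pred hds z).tsum_eq_zero_add]
    simp only [H, Nat.cast_zero, zero_mul, mul_zero, zero_add, Nat.add_sub_cancel]
    rw [← tsum_div_const]
    congr 1
    ext k
    rw [← hrec k]
    simp only [d]
    push_cast
    field_simp
  have hH1 : ∀ z, 0 ≤ z → 1 ≤ H z := fun z hz => by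
    have := (summable_mul_pow hcs z).le_tsum 0 fun k _ => mul_nonneg (hpos k).le (pow_nonneg hz k)
    rwa [pow_zero, mul_one, show c 0 = 1 from Finset.prod_range_zero _] at this
  have hH2 : ∀ z y, 0 ≤ z → z ≤ y → H z ≤ H y := fun z y hz hy =>
    (summable_mul_pow hcs z).tsum_le_tsum
      (fun k => mul_le_mul_of_nonneg_left (pow_le_pow_left₀ hz hy k) (hpos k).le)
      (summable_mul_pow hcs y)
  refine ⟨fun x => x ^ γ * H (x ^ β), fun x => K (x ^ β), H (2 ^ β), fun x hx => ?_⟩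
  have hx0 : 0 < x := hx.1
  have hp := Real.hasDerivAt_rpow_const (x := x) (p := β) (Or.inl hx0.ne')
  have hb : β - 1 = γ := by rw [hβ]; ring
  have hpw : x ^ γ = x ^ (γ - 1) * x := by
    rw [← Real.rpow_add_one hx0.ne']
    ring_nf
  have hpb : x ^ β = x ^ γ * x := by rw [hβ, Real.rpow_add_one hx0.ne']
  have hxg : 0 ≤ x ^ γ := Real.rpow_nonneg hx0.le _
  have hxb : 0 ≤ x ^ β := Real.rpow_nonneg hx0.le _
  rw [hb] at hp
  refine ⟨?_, ?_, ?_, ?_⟩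
  · convert! (Real.hasDerivAt_rpow_const (x := x) (p := γ) (Or.inl hx0.ne')).mul
      ((hH (x ^ β)).comp x hp) using 1
    simp only [Function.comp_apply]
    rw [← hHK]
    linear_combination (x ^ (γ - 1) * β * H' (x ^ β)) * hpb - (β * H' (x ^ β) * x ^ γ) * hpw
  · convert! (hK (x ^ β)).comp x hp using 1
    field_simp
  · exact le_mul_of_one_le_right hxg (hH1 _ hxb)
  · simp only
    rw [mul_comm]
    exact mul_le_mul_of_nonneg_right (hH2 _ _ hxb
      (Real.rpow_le_rpow hx0.le hx.2.le (by linarith))) hxg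

/-- Energy argument: a classical solution of the homogeneous system vanishing at both ends of
`(0, 1)` is zero. -/
theorem eq_zero_of_homogeneous_system {r : ℝ} {d G : ℝ → ℝ}
    (hd : ∀ x ∈ Ioo (0 : ℝ) 1, HasDerivAt d (x ^ r * G x) x)
    (hG : ∀ x ∈ Ioo (0 : ℝ) 1, HasDerivAt G (d x) x)
    (h0 : Tendsto d (𝓝[>] 0) (𝓝 0)) (h1 : Tendsto d (𝓝[<] 1) (𝓝 0)) :
    ∀ x ∈ Ioo (0 : ℝ) 1, d x = 0 := by
  have hdc : ContinuousOn d (Ioo 0 1) := fun x hx => (hd x hx).continuousAt.continuousWithinAt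
  have hext := continuousOn_Icc_extendFrom_Ioo hdc h0 h1
  obtain ⟨M, hM⟩ := isCompact_Icc.exists_bound_of_continuousOn hext
  have hM' : ∀ x ∈ Ioo (0 : ℝ) 1, ‖d x‖ ≤ M := fun x hx => by
    have := hM x (Ioo_subset_Icc_self hx)
    rwa [extendFrom_eq (by rw [closure_Ioo zero_ne_one]; exact Ioo_subset_Icc_self hx)
      (hdc x hx)] at this
  have hGb : ∀ x ∈ Ioo (0 : ℝ) 1, ‖G x‖ ≤ ‖G (1 / 2)‖ + M := fun x hx => by
    have hh : (1 / 2 : ℝ) ∈ Ioo (0 : ℝ) 1 := by norm_num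
    have h := Convex.norm_image_sub_le_of_norm_hasDerivWithin_le
      (fun y hy => (hG y hy).hasDerivWithinAt) hM' (convex_Ioo 0 1) hh hx
    have hMn : 0 ≤ M := (norm_nonneg _).trans (hM' x hx)
    have hx1 : ‖x - 1 / 2‖ ≤ 1 := by
      rw [Real.norm_eq_abs, abs_le]
      constructor <;> linarith [hx.1, hx.2]
    have h3 : ‖G x‖ ≤ ‖G (1 / 2)‖ + ‖G x - G (1 / 2)‖ := by
      have := norm_add_le (G (1 / 2)) (G x - G (1 / 2))
      rwa [add_sub_cancel] at this
    nlinarith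
  have hE : ∀ x ∈ Ioo (0 : ℝ) 1,
      HasDerivAt (fun y => G y * d y) (d x * d x + G x * (x ^ r * G x)) x :=
    fun x hx => (hG x hx).mul (hd x hx)
  have hmono : MonotoneOn (fun y => G y * d y) (Ioo 0 1) := by
    refine monotoneOn_of_deriv_nonneg (convex_Ioo 0 1)
      (fun x hx => (hE x hx).continuousAt.continuousWithinAt)
      (fun x hx => (hE x (interior_subset hx)).differentiableAt.differentiableWithinAt) ?_
    intro x hx
    have hx := interior_subset hx
    rw [(hE x hx).deriv]
    have := Real.rpow_nonneg hx.1.le r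
    nlinarith [mul_nonneg this (mul_self_nonneg (G x)), mul_self_nonneg (d x)]
  have hlim : ∀ l : Filter ℝ, (∀ᶠ x in l, x ∈ Ioo (0 : ℝ) 1) → Tendsto d l (𝓝 0) →
      Tendsto (fun y => G y * d y) l (𝓝 0) := fun l hl hdl => by
    refine squeeze_zero_norm' (a := fun x => (‖G (1 / 2)‖ + M) * ‖d x‖) ?_ ?_
    · filter_upwards [hl] with x hx
      rw [norm_mul]
      exact mul_le_mul_of_nonneg_right (hGb x hx) (norm_nonneg _)
    · simpa using hdl.norm.const_mul (‖G (1 / 2)‖ + M)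
  have e0 : ∀ᶠ x in 𝓝[>] (0 : ℝ), x ∈ Ioo (0 : ℝ) 1 := Ioo_mem_nhdsGT one_pos
  have e1 : ∀ᶠ x in 𝓝[<] (1 : ℝ), x ∈ Ioo (0 : ℝ) 1 := Ioo_mem_nhdsLT one_pos
  have hzero : ∀ x ∈ Ioo (0 : ℝ) 1, G x * d x = 0 := fun x hx => by
    apply le_antisymm
    · refine ge_of_tendsto (hlim _ e1 h1) ?_
      filter_upwards [Ioo_mem_nhdsLT hx.2] with y hy
      exact hmono hx ⟨hx.1.trans hy.1, hy.2⟩ hy.1.le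
    · refine le_of_tendsto (hlim _ e0 h0) ?_
      filter_upwards [Ioo_mem_nhdsGT hx.1] with y hy
      exact hmono ⟨hy.1, hy.2.trans hx.2⟩ hx hy.2.le
  intro x hx
  have h2 : HasDerivAt (fun y => G y * d y) 0 x := by
    refine (hasDerivAt_const x (0 : ℝ)).congr_of_eventuallyEq ?_
    filter_upwards [isOpen_Ioo.mem_nhds hx] with y hy using hzero y hy
  have h3 := (hE x hx).unique h2
  have h4 := mul_nonneg (Real.rpow_nonneg hx.1.le r) (mul_self_nonneg (G x))
  have h5 : d x * d x = 0 := by nlinarith [mul_self_nonneg (d x)]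
  exact mul_self_eq_zero.1 h5

theorem IsDirichletSolution.eqOn {α : ℝ} {p : ℝ≥0∞} {f u v : ℝ → ℝ}
    (hu : IsDirichletSolution α p f u) (hv : IsDirichletSolution α p f v) :
    EqOn u v (Ioc 0 1) := by
  obtain ⟨u₁, -, w, hu1, -, -, -, -, hw, heq⟩ := hu.equation
  obtain ⟨v₁, -, z, hv1, -, -, -, -, hz, heq'⟩ := hv.equation
  rw [ae_restrict_iff' measurableSet_Ioo] at heq heq'
  have hdc : ContinuousOn (fun x => u x - v x) (Ioo 0 1) :=
    (hu.continuousOn.sub hv.continuousOn).mono Ioo_subset_Ioc_self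
  obtain ⟨G, hG, hGe⟩ := (hw.sub hz).exists_hasDerivAt zero_lt_one hdc (by
    filter_upwards [heq, heq'] with x h1 h2 hx
    linarith [h1 hx, h2 hx])
  have hgc : ContinuousOn (fun x : ℝ => x ^ (-(2 * α)) * G x) (Ioo 0 1) := fun x hx =>
    ((Real.continuousAt_rpow_const x _ (Or.inl hx.1.ne')).mul
      (hG x hx).continuousAt).continuousWithinAt
  obtain ⟨D, hD, hDe⟩ := (hu1.sub hv1).exists_hasDerivAt zero_lt_one hgc (by
    filter_upwards [hGe] with x h1 hx
    rw [← h1 hx, ← mul_sub, ← mul_assoc, ← Real.rpow_add hx.1, neg_add_cancel, Real.rpow_zero,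
      one_mul])
  have hDc : ContinuousOn D (Ioo 0 1) := fun x hx => (hD x hx).continuousAt.continuousWithinAt
  have hdD : EqOn (fun x => u x - v x) D (Ioo 0 1) := by
    refine Measure.eqOn_open_of_ae_eq (μ := volume) ?_ isOpen_Ioo hdc hDc
    rw [EventuallyEq, ae_restrict_iff' measurableSet_Ioo]
    exact hDe
  have hd : ∀ x ∈ Ioo (0 : ℝ) 1,
      HasDerivAt (fun x => u x - v x) (x ^ (-(2 * α)) * G x) x := fun x hx => by
    refine (hD x hx).congr_of_eventuallyEq ?_
    filter_upwards [isOpen_Ioo.mem_nhds hx] with y hy using hdD hy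
  have h0 : Tendsto (fun x => u x - v x) (𝓝[>] 0) (𝓝 0) := by
    simpa using hu.boundary_zero.sub hv.boundary_zero
  have h1 : Tendsto (fun x => u x - v x) (𝓝[<] 1) (𝓝 0) := by
    have hc := (hu.continuousOn.sub hv.continuousOn) 1 ⟨one_pos, le_rfl⟩
    have := (hc.mono Ioo_subset_Ioc_self).tendsto
    rw [Pi.sub_apply, hu.boundary_one, hv.boundary_one, sub_zero, nhdsWithin_Ioo_eq_nhdsLT one_pos] at this
    exact this
  have key := eq_zero_of_homogeneous_system hd hG h0 h1
  intro x hx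
  rcases hx.2.lt_or_eq with h | rfl
  · exact sub_eq_zero.1 (key x ⟨hx.1, h⟩)
  · rw [hu.boundary_one, hv.boundary_one]

/-- A pair of solutions of `(x ^ (1 - γ) φ')' = φ` with Wronskian `-1`: `φ` vanishes at `0` to order
`γ`, and `ψ` vanishes at `1` and is bounded near `0`. -/
structure FundamentalPair (γ : ℝ) (φ φ₁ ψ ψ₁ : ℝ → ℝ) (A B : ℝ) : Prop where
  deriv_phi : ∀ x ∈ Ioo (0 : ℝ) 2, HasDerivAt φ (x ^ (γ - 1) * φ₁ x) x
  deriv_phi₁ : ∀ x ∈ Ioo (0 : ℝ) 2, HasDerivAt φ₁ (φ x) x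
  deriv_psi : ∀ x ∈ Ioo (0 : ℝ) 2, HasDerivAt ψ (x ^ (γ - 1) * ψ₁ x) x
  deriv_psi₁ : ∀ x ∈ Ioo (0 : ℝ) 2, HasDerivAt ψ₁ (ψ x) x
  wronskian : ∀ x ∈ Ioo (0 : ℝ) 2, φ x * ψ₁ x - φ₁ x * ψ x = -1
  le_phi : ∀ x ∈ Ioo (0 : ℝ) 2, x ^ γ ≤ φ x
  phi_le : ∀ x ∈ Ioo (0 : ℝ) 2, φ x ≤ A * x ^ γ
  psi_pos : ∀ x ∈ Ioo (0 : ℝ) 1, 0 < ψ x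
  psi_le : ∀ x ∈ Ioo (0 : ℝ) 1, ψ x ≤ B
  psi_one : ψ 1 = 0

theorem exists_fundamentalPair {γ : ℝ} (hγ : 0 < γ) :
    ∃ φ φ₁ ψ ψ₁ A B, FundamentalPair γ φ φ₁ ψ ψ₁ A B := by
  obtain ⟨φ, φ₁, A, h⟩ := exists_homogeneous_solution hγ
  have hpos : ∀ x ∈ Ioo (0 : ℝ) 2, 0 < φ x := fun x hx =>
    (Real.rpow_pos_of_pos hx.1 γ).trans_le (h x hx).2.2.1
  let q : ℝ → ℝ := fun t => t ^ (γ - 1) / φ t ^ 2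
  let R : ℝ → ℝ := fun x => ∫ t in x..1, q t
  have hq : ContinuousOn q (Ioo 0 2) := fun x hx =>
    ((Real.continuousAt_rpow_const x _ (Or.inl hx.1.ne')).div ((h x hx).1.continuousAt.pow 2)
      (pow_ne_zero _ (hpos x hx).ne')).continuousWithinAt
  have hqpos : ∀ x ∈ Ioo (0 : ℝ) 2, 0 < q x := fun x hx =>
    div_pos (Real.rpow_pos_of_pos hx.1 _) (pow_pos (hpos x hx) 2)
  have h1m : (1 : ℝ) ∈ Ioo (0 : ℝ) 2 := by norm_num
  have hqi : ∀ x ∈ Ioo (0 : ℝ) 2, IntervalIntegrable q volume x 1 := fun x hx =>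
    (hq.mono (ordConnected_Ioo.uIcc_subset hx h1m)).intervalIntegrable
  have hR : ∀ x ∈ Ioo (0 : ℝ) 2, HasDerivAt R (-q x) x := fun x hx =>
    intervalIntegral.integral_hasDerivAt_left (hqi x hx)
      (hq.stronglyMeasurableAtFilter isOpen_Ioo x hx) (hq.continuousAt (isOpen_Ioo.mem_nhds hx))
  have hRpos : ∀ x ∈ Ioo (0 : ℝ) 1, 0 < R x := fun x hx =>
    intervalIntegral.intervalIntegral_pos_of_pos_on (hqi x ⟨hx.1, by linarith [hx.2]⟩)
      (fun y hy => hqpos y ⟨hx.1.trans hy.1, by linarith [hy.2]⟩) hx.2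
  have hRle : ∀ x ∈ Ioo (0 : ℝ) 1, R x ≤ x ^ (-γ) / γ := fun x hx => by
    have hx2 : x ∈ Ioo (0 : ℝ) 2 := ⟨hx.1, by linarith [hx.2]⟩
    have hsub : ∀ t ∈ Icc x 1, t ∈ Ioo (0 : ℝ) 2 := fun t ht =>
      ⟨hx.1.trans_le ht.1, by linarith [ht.2]⟩
    have h0 : (0 : ℝ) ∉ uIcc x 1 := by
      rw [uIcc_of_le hx.2.le]
      exact fun hm => absurd hm.1 (not_le.2 hx.1)
    have hle : R x ≤ ∫ t in x..1, t ^ (-γ - 1) := by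
      refine intervalIntegral.integral_mono_on hx.2.le (hqi x hx2)
        (intervalIntegral.intervalIntegrable_rpow (Or.inr h0)) fun t ht => ?_
      have ht2 := hsub t ht
      have hp := Real.rpow_pos_of_pos ht2.1 γ
      have e : t ^ (-γ - 1) = t ^ (γ - 1) / (t ^ γ) ^ 2 := by
        rw [eq_div_iff (by positivity), ← Real.rpow_natCast, ← Real.rpow_mul ht2.1.le,
          ← Real.rpow_add ht2.1]
        congr 1
        push_cast
        ring
      rw [e]
      exact div_le_div_of_nonneg_left (Real.rpow_nonneg ht2.1.le _) (by positivity)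
        (pow_le_pow_left₀ hp.le (h t ht2).2.2.1 2)
    rw [integral_rpow (Or.inr ⟨by linarith, h0⟩), Real.one_rpow, sub_add_cancel, div_neg,
      ← neg_div, neg_sub] at hle
    exact hle.trans (div_le_div_of_nonneg_right (by linarith) hγ.le)
  have hR1 : R 1 = 0 := intervalIntegral.integral_same
  refine ⟨φ, φ₁, fun x => φ x * R x, fun x => φ₁ x * R x - (φ x)⁻¹, A, A / γ, ?_⟩
  refine ⟨fun x hx => (h x hx).1, fun x hx => (h x hx).2.1, fun x hx => ?_, fun x hx => ?_,
    fun x hx => ?_, fun x hx => (h x hx).2.2.1, fun x hx => (h x hx).2.2.2, fun x hx => ?_,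
    fun x hx => ?_, ?_⟩
  · have hp := (hpos x hx).ne'
    convert! (h x hx).1.mul (hR x hx) using 1
    simp only [q]
    field_simp
    ring
  · have hp := (hpos x hx).ne'
    convert! ((h x hx).2.1.mul (hR x hx)).sub ((h x hx).1.inv hp) using 1
    simp only [q]
    field_simp
    ring
  · have hp := (hpos x hx).ne'
    field_simp
    ring
  · exact mul_pos (hpos x ⟨hx.1, by linarith [hx.2]⟩) (hRpos x hx)
  · have hx2 : x ∈ Ioo (0 : ℝ) 2 := ⟨hx.1, by linarith [hx.2]⟩
    calc φ x * R x ≤ (A * x ^ γ) * (x ^ (-γ) / γ) :=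
          mul_le_mul (h x hx2).2.2.2 (hRle x hx) (hRpos x hx).le
            ((hpos x hx2).le.trans (h x hx2).2.2.2)
      _ = A / γ * (x ^ γ * x ^ (-γ)) := by ring
      _ = A / γ := by rw [← Real.rpow_add hx.1, add_neg_cancel, Real.rpow_zero, mul_one]
  · simp only [hR1, mul_zero]

theorem MemLpLocZeroOne.continuousOn_mul {b f : ℝ → ℝ} {p : ℝ≥0∞} (hb : ContinuousOn b (Ioc 0 1))
    (hf : MemLp f p (volume.restrict (Ioo (0 : ℝ) 1))) :
    MemLpLocZeroOne (fun x => b x * f x) p := by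
  intro ε hε
  have hf' : MemLp f p (volume.restrict (Ioo ε 1)) :=
    hf.mono_measure (Measure.restrict_mono (Ioo_subset_Ioo_left hε.1.le) le_rfl)
  have hs : Icc ε 1 ⊆ Ioc 0 1 := fun x hx => ⟨hε.1.trans_le hx.1, hx.2⟩
  obtain ⟨C, hC⟩ := isCompact_Icc.exists_bound_of_continuousOn (hb.mono hs)
  have hbm : AEStronglyMeasurable b (volume.restrict (Ioo ε 1)) :=
    (hb.mono (Ioo_subset_Icc_self.trans hs)).aestronglyMeasurable measurableSet_Ioo
  refine hf'.of_le_mul (c := C) (hbm.mul hf'.1) ?_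
  rw [ae_restrict_iff' measurableSet_Ioo]
  refine Eventually.of_forall fun x hx => ?_
  rw [norm_mul]
  exact mul_le_mul_of_nonneg_right (hC x (Ioo_subset_Icc_self hx)) (norm_nonneg _)

theorem MemLpLocZeroOne.of_continuousOn {b : ℝ → ℝ} (p : ℝ≥0∞) (hb : ContinuousOn b (Ioc 0 1)) :
    MemLpLocZeroOne b p := by
  simpa using MemLpLocZeroOne.continuousOn_mul (p := p) hb (memLp_const (1 : ℝ))

theorem HasACDerivOn.intervalIntegral {g : ℝ → ℝ} {a b c : ℝ} (hab : a ≤ b)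
    (hg : IntervalIntegrable g volume a b) (hc : c ∈ Icc a b) :
    HasACDerivOn (fun x => ∫ t in c..x, g t) g a b := by
  rw [← uIcc_of_le hab] at hc
  refine ⟨fun s t h1 h2 h3 =>
    (hg.absolutelyContinuousOnInterval_intervalIntegral hc).mono ?_, ?_⟩
  · rw [uIcc_of_le hab, uIcc_of_le h2.le]
    exact Icc_subset_Icc h1.le h3.le
  · filter_upwards [hg.ae_hasDerivAt_integral] with x hx hxm
    refine hx ?_ c hc
    rw [uIcc_of_le hab]
    exact Ioo_subset_Icc_self hxm

theorem continuousOn_intervalIntegral {g : ℝ → ℝ} {a b c : ℝ} (hab : a ≤ b)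
    (hg : IntervalIntegrable g volume a b) (hc : c ∈ Icc a b) :
    ContinuousOn (fun x => ∫ t in c..x, g t) (Icc a b) := by
  rw [← uIcc_of_le hab] at hc ⊢
  exact (hg.absolutelyContinuousOnInterval_intervalIntegral hc).continuousOn

/-- The solution given by the Green function of a fundamental pair. -/
noncomputable def greenSolution (φ ψ f : ℝ → ℝ) (x : ℝ) : ℝ :=
  ψ x * (∫ t in (0 : ℝ)..x, φ t * f t) - φ x * ∫ t in (1 : ℝ)..x, ψ t * f t

namespace FundamentalPair

variable {γ A B : ℝ} {φ φ₁ ψ ψ₁ f : ℝ → ℝ}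

theorem intervalIntegrable_bdd_mul {b f : ℝ → ℝ} {C : ℝ} (hb : ContinuousOn b (Ioo 0 1))
    (hC : ∀ x ∈ Ioo (0 : ℝ) 1, |b x| ≤ C) (hf : IntegrableOn f (Ioo 0 1)) :
    IntervalIntegrable (fun x => b x * f x) volume 0 1 := by
  rw [intervalIntegrable_iff_integrableOn_Ioo_of_le zero_le_one]
  refine Integrable.bdd_mul (c := C) hf (hb.aestronglyMeasurable measurableSet_Ioo) ?_
  rw [ae_restrict_iff' measurableSet_Ioo]
  exact Eventually.of_forall hC

theorem Ioo_subset {x : ℝ} (hx : x ∈ Ioc (0 : ℝ) 1) : x ∈ Ioo (0 : ℝ) 2 :=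
  ⟨hx.1, by linarith [hx.2]⟩

theorem phi_pos (h : FundamentalPair γ φ φ₁ ψ ψ₁ A B) {x : ℝ} (hx : x ∈ Ioc (0 : ℝ) 1) : 0 < φ x :=
  (Real.rpow_pos_of_pos hx.1 γ).trans_le (h.le_phi x (Ioo_subset hx))

theorem A_pos (h : FundamentalPair γ φ φ₁ ψ ψ₁ A B) : 0 < A := by
  have h1 : (1 : ℝ) ∈ Ioc (0 : ℝ) 1 := by norm_num
  have := (h.phi_pos h1).trans_le (h.phi_le 1 (Ioo_subset h1))
  simpa using this

theorem B_pos (h : FundamentalPair γ φ φ₁ ψ ψ₁ A B) : 0 < B := by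
  have h1 : (1 / 2 : ℝ) ∈ Ioo (0 : ℝ) 1 := by norm_num
  exact (h.psi_pos _ h1).trans_le (h.psi_le _ h1)

theorem psi_nonneg (h : FundamentalPair γ φ φ₁ ψ ψ₁ A B) {x : ℝ} (hx : x ∈ Ioc (0 : ℝ) 1) :
    0 ≤ ψ x := by
  rcases hx.2.lt_or_eq with h1 | rfl
  · exact (h.psi_pos x ⟨hx.1, h1⟩).le
  · exact h.psi_one.ge

theorem psi_le' (h : FundamentalPair γ φ φ₁ ψ ψ₁ A B) {x : ℝ} (hx : x ∈ Ioc (0 : ℝ) 1) :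
    ψ x ≤ B := by
  rcases hx.2.lt_or_eq with h1 | rfl
  · exact h.psi_le x ⟨hx.1, h1⟩
  · exact h.psi_one.le.trans h.B_pos.le

theorem phi_le_of_le (hγ : 0 < γ) (h : FundamentalPair γ φ φ₁ ψ ψ₁ A B) {x y : ℝ} (hx : 0 < x)
    (hxy : x ≤ y) (hy : y ≤ 1) : φ x ≤ A * y ^ γ :=
  (h.phi_le x (Ioo_subset ⟨hx, hxy.trans hy⟩)).trans
    (mul_le_mul_of_nonneg_left (Real.rpow_le_rpow hx.le hxy hγ.le) h.A_pos.le)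

theorem continuousOn_phi (h : FundamentalPair γ φ φ₁ ψ ψ₁ A B) : ContinuousOn φ (Ioc 0 1) :=
  fun x hx => (h.deriv_phi x (Ioo_subset hx)).continuousAt.continuousWithinAt

theorem continuousOn_phi₁ (h : FundamentalPair γ φ φ₁ ψ ψ₁ A B) : ContinuousOn φ₁ (Ioc 0 1) :=
  fun x hx => (h.deriv_phi₁ x (Ioo_subset hx)).continuousAt.continuousWithinAt

theorem continuousOn_psi (h : FundamentalPair γ φ φ₁ ψ ψ₁ A B) : ContinuousOn ψ (Ioc 0 1) :=
  fun x hx => (h.deriv_psi x (Ioo_subset hx)).continuousAt.continuousWithinAt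

theorem continuousOn_psi₁ (h : FundamentalPair γ φ φ₁ ψ ψ₁ A B) : ContinuousOn ψ₁ (Ioc 0 1) :=
  fun x hx => (h.deriv_psi₁ x (Ioo_subset hx)).continuousAt.continuousWithinAt

theorem intervalIntegrable_phi_mul (hγ : 0 < γ) (h : FundamentalPair γ φ φ₁ ψ ψ₁ A B)
    (hf : IntegrableOn f (Ioo 0 1)) : IntervalIntegrable (fun x => φ x * f x) volume 0 1 :=
  intervalIntegrable_bdd_mul (C := A * 1 ^ γ) (h.continuousOn_phi.mono Ioo_subset_Ioc_self)
    (fun x hx => by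
      rw [abs_of_pos (h.phi_pos (Ioo_subset_Ioc_self hx))]
      exact h.phi_le_of_le hγ hx.1 hx.2.le le_rfl) hf

theorem intervalIntegrable_psi_mul (h : FundamentalPair γ φ φ₁ ψ ψ₁ A B)
    (hf : IntegrableOn f (Ioo 0 1)) : IntervalIntegrable (fun x => ψ x * f x) volume 0 1 :=
  intervalIntegrable_bdd_mul (h.continuousOn_psi.mono Ioo_subset_Ioc_self)
    (fun x hx => by
      rw [abs_of_pos (h.psi_pos x hx)]
      exact h.psi_le x hx) hf

theorem abs_intervalIntegral_le {b f : ℝ → ℝ} {C s t : ℝ} (hst : s ≤ t) (hs : 0 ≤ s) (ht : t ≤ 1)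
    (hC0 : 0 ≤ C) (hC : ∀ x ∈ Ioc s t, |b x| ≤ C) (hf : IntegrableOn f (Ioo 0 1)) :
    |∫ x in s..t, b x * f x| ≤ C * ∫ x in Ioo (0 : ℝ) 1, |f x| := by
  have hfi : IntegrableOn f (Ioo s t) := hf.mono_set (Ioo_subset_Ioo hs ht)
  have h1 : ‖∫ x in s..t, b x * f x‖ ≤ ∫ x in s..t, C * |f x| := by
    refine intervalIntegral.norm_integral_le_of_norm_le hst ?_ ?_
    · refine Eventually.of_forall fun x hx => ?_
      rw [norm_mul]
      exact mul_le_mul_of_nonneg_right (hC x hx) (norm_nonneg _)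
    · exact ((intervalIntegrable_iff_integrableOn_Ioo_of_le hst).2 hfi.abs).const_mul C
  refine h1.trans ?_
  rw [intervalIntegral.integral_const_mul, intervalIntegral.integral_of_le hst,
    integral_Ioc_eq_integral_Ioo]
  refine mul_le_mul_of_nonneg_left ?_ hC0
  exact setIntegral_mono_set hf.abs (Eventually.of_forall fun x => abs_nonneg _)
    (Ioo_subset_Ioo hs ht).eventuallyLE

theorem abs_greenSolution_le (hγ : 0 < γ) (h : FundamentalPair γ φ φ₁ ψ ψ₁ A B)
    (hf : IntegrableOn f (Ioo 0 1)) {x : ℝ} (hx : x ∈ Ioc (0 : ℝ) 1) :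
    |greenSolution φ ψ f x| ≤ 2 * A * B * x ^ γ * ∫ t in Ioo (0 : ℝ) 1, |f t| := by
  have hA := h.A_pos
  have hB := h.B_pos
  have hxg := Real.rpow_nonneg hx.1.le γ
  have h1 : |∫ t in (0 : ℝ)..x, φ t * f t| ≤ A * x ^ γ * ∫ t in Ioo (0 : ℝ) 1, |f t| :=
    abs_intervalIntegral_le hx.1.le le_rfl hx.2 (by positivity) (fun t ht => by
      rw [abs_of_pos (h.phi_pos ⟨ht.1, ht.2.trans hx.2⟩)]
      exact h.phi_le_of_le hγ ht.1 ht.2 hx.2) hf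
  have h2 : |∫ t in (1 : ℝ)..x, ψ t * f t| ≤ B * ∫ t in Ioo (0 : ℝ) 1, |f t| := by
    rw [intervalIntegral.integral_symm, abs_neg]
    exact abs_intervalIntegral_le hx.2 hx.1.le le_rfl hB.le (fun t ht => by
      have ht' : t ∈ Ioc (0 : ℝ) 1 := ⟨hx.1.trans ht.1, ht.2⟩
      rw [abs_of_nonneg (h.psi_nonneg ht')]
      exact h.psi_le' ht') hf
  have h3 : |ψ x| ≤ B := by
    rw [abs_of_nonneg (h.psi_nonneg hx)]
    exact h.psi_le' hx
  have h4 : |φ x| ≤ A * x ^ γ := by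
    rw [abs_of_pos (h.phi_pos hx)]
    exact h.phi_le x (Ioo_subset hx)
  have hI : 0 ≤ ∫ t in Ioo (0 : ℝ) 1, |f t| := integral_nonneg fun t => abs_nonneg _
  calc |greenSolution φ ψ f x|
      ≤ |ψ x * ∫ t in (0 : ℝ)..x, φ t * f t| + |φ x * ∫ t in (1 : ℝ)..x, ψ t * f t| := abs_sub _ _
    _ = |ψ x| * |∫ t in (0 : ℝ)..x, φ t * f t| + |φ x| * |∫ t in (1 : ℝ)..x, ψ t * f t| := by
        rw [abs_mul, abs_mul]
    _ ≤ B * (A * x ^ γ * ∫ t in Ioo (0 : ℝ) 1, |f t|)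
        + A * x ^ γ * (B * ∫ t in Ioo (0 : ℝ) 1, |f t|) := by gcongr
    _ = _ := by ring

theorem le_greenSolution_one (h : FundamentalPair γ φ φ₁ ψ ψ₁ A B) {x : ℝ}
    (hx : 0 < x) (hx' : x ≤ 1 / 2) :
    (∫ t in (1 / 2 : ℝ)..1, ψ t) * x ^ γ ≤ greenSolution φ ψ (fun _ => 1) x := by
  have hxm : x ∈ Ioc (0 : ℝ) 1 := ⟨hx, by linarith⟩
  have hi : IntegrableOn (fun _ : ℝ => (1 : ℝ)) (Ioo 0 1) := integrableOn_const (by simp)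
  have hψ := h.intervalIntegrable_psi_mul hi
  simp only [greenSolution, mul_one] at hψ ⊢
  have h1 : 0 ≤ ∫ t in (0 : ℝ)..x, φ t := by
    rw [intervalIntegral.integral_of_le hx.le]
    exact setIntegral_nonneg measurableSet_Ioc fun t ht =>
      (h.phi_pos ⟨ht.1, ht.2.trans hxm.2⟩).le
  have h2 : ∫ t in (1 / 2 : ℝ)..1, ψ t ≤ ∫ t in x..1, ψ t := by
    refine intervalIntegral.integral_mono_interval hx' (by norm_num) le_rfl ?_ ?_
    · rw [EventuallyLE, ae_restrict_iff' measurableSet_Ioc]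
      exact Eventually.of_forall fun t ht => h.psi_nonneg ⟨hx.trans ht.1, ht.2⟩
    · refine hψ.mono_set ?_
      rw [uIcc_of_le hxm.2, uIcc_of_le zero_le_one]
      exact Icc_subset_Icc_left hx.le
  have h3 : 0 ≤ ∫ t in (1 / 2 : ℝ)..1, ψ t := by
    rw [intervalIntegral.integral_of_le (by norm_num)]
    exact setIntegral_nonneg measurableSet_Ioc fun t ht => h.psi_nonneg ⟨by linarith [ht.1], ht.2⟩
  rw [intervalIntegral.integral_symm x 1, mul_neg, sub_neg_eq_add]
  have h4 := mul_nonneg (h.psi_nonneg hxm) h1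
  have h5 := mul_le_mul h2 (h.le_phi x (Ioo_subset hxm)) (Real.rpow_nonneg hx.le γ) (h3.trans h2)
  linarith

theorem isDirichletSolution_greenSolution {α : ℝ} {p : ℝ≥0∞} (hp : 1 ≤ p) (hγα : γ = 1 - 2 * α)
    (hγ : 0 < γ) (h : FundamentalPair γ φ φ₁ ψ ψ₁ A B)
    (hf : MemLp f p (volume.restrict (Ioo (0 : ℝ) 1))) :
    IsDirichletSolution α p f (greenSolution φ ψ f) := by
  have hfi : IntegrableOn f (Ioo 0 1) := hf.integrable hp
  have hP := h.intervalIntegrable_phi_mul hγ hfi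
  have hQ := h.intervalIntegrable_psi_mul hfi
  have m0 : (0 : ℝ) ∈ Icc (0 : ℝ) 1 := by norm_num
  have m1 : (1 : ℝ) ∈ Icc (0 : ℝ) 1 := by norm_num
  set P : ℝ → ℝ := fun x => ∫ t in (0 : ℝ)..x, φ t * f t with hPdef
  set Q : ℝ → ℝ := fun x => ∫ t in (1 : ℝ)..x, ψ t * f t with hQdef
  have dP : HasACDerivOn P (fun x => φ x * f x) 0 1 := .intervalIntegral zero_le_one hP m0
  have dQ : HasACDerivOn Q (fun x => ψ x * f x) 0 1 := .intervalIntegral zero_le_one hQ m1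
  have cP : ContinuousOn P (Ioc 0 1) :=
    (continuousOn_intervalIntegral zero_le_one hP m0).mono Ioc_subset_Icc_self
  have cQ : ContinuousOn Q (Ioc 0 1) :=
    (continuousOn_intervalIntegral zero_le_one hQ m1).mono Ioc_subset_Icc_self
  have cpow : ∀ r : ℝ, ContinuousOn (fun x : ℝ => x ^ r) (Ioc 0 1) := fun r x hx =>
    (Real.continuousAt_rpow_const x _ (Or.inl hx.1.ne')).continuousWithinAt
  have dpow : ∀ r : ℝ, HasACDerivOn (fun x : ℝ => x ^ r) (fun x => r * x ^ (r - 1)) 0 1 := fun r =>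
    .of_hasDerivAt (fun x hx => Real.hasDerivAt_rpow_const (Or.inl hx.1.ne'))
      (continuousOn_const.mul ((cpow _).mono Ioo_subset_Ioc_self))
  have hsub : Ioo (0 : ℝ) 1 ⊆ Ioc 0 1 := Ioo_subset_Ioc_self
  have dφ : HasACDerivOn φ (fun x => x ^ (γ - 1) * φ₁ x) 0 1 :=
    .of_hasDerivAt (fun x hx => h.deriv_phi x (Ioo_subset (hsub hx)))
      (((cpow _).mul h.continuousOn_phi₁).mono hsub)
  have dφ₁ : HasACDerivOn φ₁ φ 0 1 :=
    .of_hasDerivAt (fun x hx => h.deriv_phi₁ x (Ioo_subset (hsub hx))) (h.continuousOn_phi.mono hsub)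
  have dψ : HasACDerivOn ψ (fun x => x ^ (γ - 1) * ψ₁ x) 0 1 :=
    .of_hasDerivAt (fun x hx => h.deriv_psi x (Ioo_subset (hsub hx)))
      (((cpow _).mul h.continuousOn_psi₁).mono hsub)
  have dψ₁ : HasACDerivOn ψ₁ ψ 0 1 :=
    .of_hasDerivAt (fun x hx => h.deriv_psi₁ x (Ioo_subset (hsub hx))) (h.continuousOn_psi.mono hsub)
  have dneg : ∀ {U v : ℝ → ℝ}, HasACDerivOn U v 0 1 →
      HasACDerivOn (fun x => -U x) (fun x => -v x) 0 1 := fun hU =>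
    ⟨fun c d h1 h2 h3 => (hU.1 c d h1 h2 h3).neg, by
      filter_upwards [hU.2] with x h1 hx using (h1 hx).neg⟩
  set u : ℝ → ℝ := greenSolution φ ψ f with hu
  have hux : ∀ x, u x = ψ x * P x - φ x * Q x := fun x => rfl
  have hueq : u = fun x => ψ x * P x + -(φ x * Q x) := funext fun x => by rw [hux]; ring
  have cu : ContinuousOn u (Ioc 0 1) :=
    (h.continuousOn_psi.mul cP).sub (h.continuousOn_phi.mul cQ)
  let F : ℝ → ℝ := fun x => ψ₁ x * P x + -(φ₁ x * Q x)
  have cF : ContinuousOn F (Ioc 0 1) :=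
    (h.continuousOn_psi₁.mul cP).add (h.continuousOn_phi₁.mul cQ).neg
  have du : HasACDerivOn u (fun x => x ^ (γ - 1) * F x) 0 1 := by
    rw [hueq]
    refine ((dψ.mul dP).add (dneg (dφ.mul dQ))).congr (Eventually.of_forall fun x hx => ?_)
    simp only [F]
    ring
  have dF : HasACDerivOn F (fun x => u x - f x) 0 1 := by
    refine ((dψ₁.mul dP).add (dneg (dφ₁.mul dQ))).congr (Eventually.of_forall fun x hx => ?_)
    have hw := h.wronskian x (Ioo_subset (hsub hx))
    simp only [hux]
    linear_combination f x * hw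
  have du₁ := (dpow (γ - 1)).mul dF
  refine ⟨cu, ⟨_, _, fun x => u x - f x, du.hasWeakDerivOn one_pos, du₁.hasWeakDerivOn one_pos,
    .of_continuousOn p cu, .of_continuousOn p ((cpow _).mul cF), ?_, ?_, ?_⟩, ?_, ?_⟩
  · have c1 : ContinuousOn (fun x => (γ - 1) * x ^ (γ - 1 - 1) * F x + x ^ (γ - 1) * u x)
        (Ioc 0 1) := ((continuousOn_const.mul (cpow _)).mul cF).add ((cpow _).mul cu)
    intro ε hε
    refine ((MemLpLocZeroOne.of_continuousOn p c1 ε hε).sub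
      (MemLpLocZeroOne.continuousOn_mul (cpow (γ - 1)) hf ε hε)).ae_eq
      (Eventually.of_forall fun x => ?_)
    simp only [Pi.sub_apply]
    ring
  · refine HasACDerivOn.hasWeakDerivOn one_pos (((dpow (2 * α)).mul du₁).congr
      (Eventually.of_forall fun x hx => ?_))
    have hx0 : x ≠ 0 := hx.1.ne'
    have e1 : x ^ (2 * α) * x ^ (γ - 1) = 1 := by
      rw [← Real.rpow_add hx.1, show 2 * α + (γ - 1) = 0 by rw [hγα]; ring, Real.rpow_zero]
    rw [Real.rpow_sub_one hx0 (2 * α), Real.rpow_sub_one hx0 (γ - 1)]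
    have e2 : 2 * α = 1 - γ := by rw [hγα]; ring
    have e3 : 2 * α * (x ^ (2 * α) / x) * (x ^ (γ - 1) * F x) + x ^ (2 * α) *
        ((γ - 1) * (x ^ (γ - 1) / x) * F x + x ^ (γ - 1) * (u x - f x)) =
        x ^ (2 * α) * x ^ (γ - 1) * ((2 * α + (γ - 1)) * (F x / x) + (u x - f x)) := by ring
    rw [e3, e1, show 2 * α + (γ - 1) = 0 by rw [e2]; ring]
    ring
  · exact Eventually.of_forall fun x => by ring
  · rw [hux, h.psi_one, hQdef]
    simp
  · have hlim : Tendsto (fun x : ℝ => 2 * A * B * x ^ γ * ∫ t in Ioo (0 : ℝ) 1, |f t|)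
        (𝓝[>] 0) (𝓝 0) := by
      have h1 : Tendsto (fun x : ℝ => x ^ γ) (𝓝[>] 0) (𝓝 0) := by
        have := (Real.continuousAt_rpow_const 0 γ (Or.inr hγ.le)).tendsto
        rw [Real.zero_rpow hγ.ne'] at this
        exact this.mono_left nhdsWithin_le_nhds
      simpa using (h1.const_mul (2 * A * B)).mul_const (∫ t in Ioo (0 : ℝ) 1, |f t|)
    refine squeeze_zero_norm' ?_ hlim
    filter_upwards [Ioc_mem_nhdsGT one_pos] with x hx using h.abs_greenSolution_le hγ hfi hx

end FundamentalPair

theorem integral_abs_le_one {f : ℝ → ℝ} {p : ℝ≥0∞} {μ : Measure ℝ} [IsProbabilityMeasure μ]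
    (hp : 1 ≤ p) (hf : MemLp f p μ) (h1 : eLpNorm f p μ ≤ 1) : ∫ x, |f x| ∂μ ≤ 1 := by
  have h2 := (eLpNorm_le_eLpNorm_of_exponent_le hp hf.1).trans h1
  rw [eLpNorm_one_eq_lintegral_enorm] at h2
  have h3 := integral_norm_eq_lintegral_enorm hf.1
  simp only [Real.norm_eq_abs] at h3
  rw [h3]
  exact ENNReal.toReal_le_of_le_ofReal zero_le_one (by simpa using h2)

theorem mainTheorem3 (α : ℝ) (hα : α < 1 / 2) (hα0 : α ≠ 0) (p : ℝ≥0∞) (hp : 1 ≤ p) :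
    (∀ f : ℝ → ℝ, MemLp f p (volume.restrict (Ioo (0 : ℝ) 1)) →
      ∃ u : ℝ → ℝ, IsDirichletSolution α p f u ∧
        ∀ v : ℝ → ℝ, IsDirichletSolution α p f v → EqOn v u (Ioc 0 1)) ∧
    ∃ ε₀ C₁ C₂ : ℝ, 0 < ε₀ ∧ ε₀ < 1 ∧ 0 < C₁ ∧ C₁ < C₂ ∧
      ∀ x : ℝ, 0 < x → x ≤ ε₀ →
        ENNReal.ofReal C₁ ≤ dirichletK α p x ∧ dirichletK α p x ≤ ENNReal.ofReal C₂ := by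
  have hγ : 0 < 1 - 2 * α := by linarith
  obtain ⟨φ, φ₁, ψ, ψ₁, A, B, h⟩ := exists_fundamentalPair hγ
  have hA := h.A_pos
  have hB := h.B_pos
  have hprob : IsProbabilityMeasure (volume.restrict (Ioo (0 : ℝ) 1)) := ⟨by simp⟩
  have hsol : ∀ f : ℝ → ℝ, MemLp f p (volume.restrict (Ioo (0 : ℝ) 1)) →
      IsDirichletSolution α p f (greenSolution φ ψ f) := fun f hf =>
    h.isDirichletSolution_greenSolution hp rfl hγ hf
  have hone : MemLp (fun _ : ℝ => (1 : ℝ)) p (volume.restrict (Ioo (0 : ℝ) 1)) := memLp_const 1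
  have hmul : ∀ {x : ℝ}, 0 < x → x ^ (2 * α - 1) * x ^ (1 - 2 * α) = 1 := fun hx => by
    rw [← Real.rpow_add hx, show 2 * α - 1 + (1 - 2 * α) = 0 by ring, Real.rpow_zero]
  set c := ∫ t in (1 / 2 : ℝ)..1, ψ t with hc
  have hcpos : 0 < c := by
    have hψ := h.intervalIntegrable_psi_mul (f := fun _ => 1) (integrableOn_const (by simp))
    simp only [mul_one] at hψ
    refine intervalIntegral.intervalIntegral_pos_of_pos_on (hψ.mono_set ?_)
      (fun x hx => h.psi_pos x ⟨by linarith [hx.1], hx.2⟩) (by norm_num)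
    rw [uIcc_of_le (by norm_num), uIcc_of_le zero_le_one]
    exact Icc_subset_Icc_left (by norm_num)
  refine ⟨fun f hf => ⟨_, hsol f hf, fun v hv => hv.eqOn (hsol f hf)⟩,
    1 / 2, c, c + 2 * A * B, by norm_num, by norm_num, hcpos, by linarith [mul_pos hA hB],
    fun x hx hx' => ⟨?_, ?_⟩⟩
  · have h1 : ENNReal.ofReal c ≤
        ENNReal.ofReal |x ^ (2 * α - 1) * greenSolution φ ψ (fun _ => 1) x| := by
      refine ENNReal.ofReal_le_ofReal (le_trans ?_ (le_abs_self _))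
      have := mul_le_mul_of_nonneg_left (h.le_greenSolution_one hx hx')
        (Real.rpow_nonneg hx.le (2 * α - 1))
      rwa [mul_left_comm, hmul hx, mul_one] at this
    refine h1.trans ?_
    have hn : eLpNorm (fun _ : ℝ => (1 : ℝ)) p (volume.restrict (Ioo (0 : ℝ) 1)) ≤ 1 := by
      rw [eLpNorm_const _ (one_pos.trans_le hp).ne' hprob.ne_zero]
      simp
    exact le_iSup_of_le (fun _ => 1) (le_iSup_of_le (greenSolution φ ψ fun _ => 1)
      (le_iSup_of_le ⟨hone, hn, hsol _ hone⟩ le_rfl))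
  · refine iSup_le fun f => iSup_le fun u => iSup_le fun hfu => ?_
    obtain ⟨hf, hf1, hu⟩ := hfu
    have hxm : x ∈ Ioc (0 : ℝ) 1 := ⟨hx, by linarith⟩
    rw [hu.eqOn (hsol f hf) hxm]
    refine ENNReal.ofReal_le_ofReal ?_
    have h1 := h.abs_greenSolution_le hγ (hf.integrable hp) hxm
    have h2 := integral_abs_le_one hp hf hf1
    have hxp := Real.rpow_pos_of_pos hx (1 - 2 * α)
    have hxq := Real.rpow_nonneg hx.le (2 * α - 1)
    have h3 : |greenSolution φ ψ f x| ≤ 2 * A * B * x ^ (1 - 2 * α) :=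
      h1.trans (mul_le_of_le_one_right (by positivity) h2)
    rw [abs_mul, abs_of_nonneg hxq]
    have h4 := mul_le_mul_of_nonneg_left h3 hxq
    rw [mul_left_comm, hmul hx, mul_one] at h4
    linarith
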